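/- \textbf{Setting.} Let $X$ be a finite graph in the sense of Serre: a finite set of vertices, a finite set of edges, each edge $a$ having an origin $\mathrm{o}(a)$, an extremity $\mathrm{e}(a)$ and an opposite edge $-a\neq a$ with $-(-a)=a$, $\mathrm{o}(-a)=\mathrm{e}(a)$ and $\mathrm{e}(-a)=\mathrm{o}(a)$. Let $X$ be oriented by a set of positive edges containing exactly one edge of each pair $\{a,-a\}$, and let $T$ be a maximal tree of $X$, i.e. a subgraph with the same vertices in which any two vertices are joined by exactly one reduced path (so $X$ is connected). Let $(\mathcal G,X)$ be a graph of groups on $X$: a group $G_s$ for each vertex $s$, a group $G_a$ for each positive edge $a$, and monomorphisms $\phi_a:G_a\to G_{\mathrm{o}(a)}$, $\phi_{-a}:G_a\to G_{\mathrm{e}(a)}$. Its fundamental group $\pi_1(\mathcal G,X)$, with respect to $T$, is the quotient of the free product of all the $G_s$ and of the free group on $\{t_a : a \text{ an edge of } X\}$ by the relations $$\phi_a(k)=t_a\,\phi_{-a}(k)\,t_a^{-1}\ (a \text{ positive},\ k\in G_a),\qquad t_{-a}=t_a^{-1}\ (a \text{ an edge of } X),\qquad t_a=1\ (a \text{ an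 edge of } T).$$ Each $G_s$ maps naturally to $\pi_1(\mathcal G,X)$, and we denote an element of $G_s$ and its image by the same letter. For a positive edge $a$ put $G_a^-=\phi_a(G_a)\subset G_{\mathrm{o}(a)}$, $G_a^+=\phi_{-a}(G_a)\subset G_{\mathrm{e}(a)}$, and let $\varphi_a:G_a^-\to G_a^+$ be the isomorphism $\phi_a(k)\mapsto\phi_{-a}(k)$; put $G_{-a}^{\mp}=G_a^{\pm}$ and $\varphi_{-a}=\varphi_a^{-1}$. \textbf{Trajets.} Let $u\in G_{s}$ and $v\in G_{s'}$. A \emph{trajet} from $u$ to $v$, with origin $s$ and extremity $s'$, consists of a path $(a_1,\dots,a_n)$ of $X$ ($n\ge 0$) from $s=s_0$ to $s'=s_n$, with successive vertices $s_0,\dots,s_n$, of elements $c_i^-\in G_{a_i}^-$ and $c_i^+=\varphi_{a_i}(c_i^-)\in G_{a_i}^+$ for $1\le i\le n$, and of elements $h_i\in G_{s_i}$ for $0\le i\le n$, such that $u=h_0vh_0^{-1}$ in $G_{s_0}$ if $n=0$, and, if $n\ge 1$, $$u=h_0c_1^-h_0^{-1}\ \text{in } G_{s_0},\qquad c_i^+=h_ic_{i+1}^-h_i^{-1}\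 \text{in } G_{s_i}\ (1\le i\le n-1),\qquad c_n^+=h_nvh_n^{-1}\ \text{in } G_{s_n}.$$ Its \emph{label} is the element $h_0t_{a_1}h_1t_{a_2}\cdots t_{a_n}h_n$ of $\pi_1(\mathcal G,X)$. A \emph{circuit} at $u\in G_s$ is a trajet from $u$ to $u$ with origin and extremity $s$, and $\mathcal C(u)$ is the set of the labels of the circuits at $u$. \textbf{Proposition (fundamental theorem of trajets).} Let $u\in G_{s_1}$, $v\in G_{s_2}$ and $h\in\pi_1(\mathcal G,X)$. Then $u=hvh^{-1}$ in $\pi_1(\mathcal G,X)$ if and only if there is a trajet from $u$ to $v$, with origin $s_1$ and extremity $s_2$, whose label is $h$. \textbf{Corollary.} Let $u\in G_s$. Then the centralizer of $u$ in $\pi_1(\mathcal G,X)$ is the set $\mathcal C(u)$. -/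

import Mathlib

/-!
Graphs are quivers `V` with an involutive reversal of the edges: an edge `a : s ⟶ t` has origin
`s`, extremity `t`, and opposite edge `Quiver.reverse a : t ⟶ s`.  Paths are `Quiver.Path`.
-/

open Quiver

universe u v w x

/-- A path is reduced if it never runs through an edge and then at once through its opposite. -/
def Quiver.Path.IsReducedPath {V : Type u} [Quiver.{v} V] [HasInvolutiveReverse V] {s t : V}
    (p : Path s t) : Prop :=
  ∀ ⦃y z : V⦄ (q : Path s y) (a : y ⟶ z) (r : Path y t),
    p ≠ ((q.cons a).cons (Quiver.reverse a)).comp r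

/-- All the edges of the path lie in the given set of edges. -/
def Quiver.Path.EdgesIn {V : Type u} [Quiver.{v} V] (H : WideSubquiver V) {s : V} :
    ∀ {t : V}, Path s t → Prop
  | _, .nil => True
  | _, .cons (b := b) (c := c) p a => p.EdgesIn H ∧ a ∈ H b c

/-- A maximal tree of a graph: a subgraph which has all the vertices and is a tree, i.e.
any two vertices are joined in it by exactly one reduced path (the empty path is allowed). -/
structure MaximalTree (V : Type u) [Quiver.{v} V] [HasInvolutiveReverse V] where
  /-- the edges of the tree -/
  edges : WideSubquiver V
  reverse_mem : ∀ ⦃s t : V⦄ (a : s ⟶ t), a ∈ edges s t → reverse a ∈ edges t s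
  existsUnique_path : ∀ s t : V, ∃! p : Path s t, p.EdgesIn edges ∧ p.IsReducedPath

/-- A graph of groups on the graph `V`: an orientation (a set of positive edges which contains
exactly one of any two opposite edges; in particular no edge is its own opposite), vertex groups,
an edge group for each positive edge, and two monomorphisms from each edge group to the
groups of the two endpoints. Connectedness of the graph is not included here: it follows from
the existence of a maximal tree. -/
structure GraphOfGroups (V : Type u) [Quiver.{v} V] [HasInvolutiveReverse V] where
  /-- the orientation -/
  IsPos : ∀ ⦃s t : V⦄, (s ⟶ t) → Prop
  isPos_xor : ∀ ⦃s t : V⦄ (a : s ⟶ t), Xor (IsPos a) (IsPos (reverse a))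
  /-- the group `G_s` of the vertex `s` -/
  vertexGroup : V → Type w
  [vertexGroupInst : ∀ s, Group (vertexGroup s)]
  /-- the group `G_a` of the positive edge `a` -/
  edgeGroup : ∀ ⦃s t : V⦄ (a : s ⟶ t), IsPos a → Type x
  [edgeGroupInst : ∀ ⦃s t : V⦄ (a : s ⟶ t) (ha : IsPos a), Group (edgeGroup a ha)]
  /-- the monomorphism `ϕ_a` from the edge group into the group of the origin -/
  toOrigin : ∀ ⦃s t : V⦄ (a : s ⟶ t) (ha : IsPos a), edgeGroup a ha →* vertexGroup s
  /-- the monomorphism `ϕ_{-a}` from the edge group into the group of the extremity -/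
  toExtremity : ∀ ⦃s t : V⦄ (a : s ⟶ t) (ha : IsPos a), edgeGroup a ha →* vertexGroup t
  toOrigin_injective : ∀ ⦃s t : V⦄ (a : s ⟶ t) (ha : IsPos a), Function.Injective (toOrigin a ha)
  toExtremity_injective :
    ∀ ⦃s t : V⦄ (a : s ⟶ t) (ha : IsPos a), Function.Injective (toExtremity a ha)

attribute [instance] GraphOfGroups.vertexGroupInst GraphOfGroups.edgeGroupInst

namespace GraphOfGroups

/-- The free product of all the vertex groups and of the free group on the `t_a`,
where `a` runs over all the edges (of both signs). -/
abbrev FreeProd {V : Type u} [Quiver.{v} V] [HasInvolutiveReverse V]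
    (G : GraphOfGroups.{u, v, w, x} V) : Type (max u v w) :=
  Monoid.Coprod (Monoid.CoprodI G.vertexGroup) (FreeGroup (Total V))

/-- The inclusion of a vertex group in the free product. -/
def vertexGen {V : Type u} [Quiver.{v} V] [HasInvolutiveReverse V]
    (G : GraphOfGroups.{u, v, w, x} V) (s : V) : G.vertexGroup s →* G.FreeProd :=
  Monoid.Coprod.inl.comp Monoid.CoprodI.of

/-- The generator `t_a` of the free product. -/
def edgeGen {V : Type u} [Quiver.{v} V] [HasInvolutiveReverse V]
    (G : GraphOfGroups.{u, v, w, x} V) {s t : V} (a : s ⟶ t) : G.FreeProd :=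
  Monoid.Coprod.inr (FreeGroup.of ⟨s, t, a⟩)

/-- The relators of the fundamental group. -/
inductive Relator {V : Type u} [Quiver.{v} V] [HasInvolutiveReverse V]
    (G : GraphOfGroups.{u, v, w, x} V) (T : MaximalTree V) : G.FreeProd → Prop
  /-- `ϕ_a(k) = t_a ϕ_{-a}(k) t_a⁻¹` for `a` positive and `k` in `G_a` -/
  | conj {s t : V} (a : s ⟶ t) (ha : G.IsPos a) (k : G.edgeGroup a ha) :
      Relator G T (G.vertexGen s (G.toOrigin a ha k) *
        (G.edgeGen a * G.vertexGen t (G.toExtremity a ha k) * (G.edgeGen a)⁻¹)⁻¹)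
  /-- `t_{-a} = t_a⁻¹` for every edge `a` -/
  | inv {s t : V} (a : s ⟶ t) : Relator G T (G.edgeGen (reverse a) * ((G.edgeGen a)⁻¹)⁻¹)
  /-- `t_a = 1` for every edge `a` of the tree -/
  | tree {s t : V} (a : s ⟶ t) (ha : a ∈ T.edges s t) : Relator G T (G.edgeGen a)

/-- The fundamental group of the graph of groups `G` decomposed by the maximal tree `T`. -/
abbrev FundamentalGroup {V : Type u} [Quiver.{v} V] [HasInvolutiveReverse V]
    (G : GraphOfGroups.{u, v, w, x} V) (T : MaximalTree V) : Type (max u v w) :=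
  G.FreeProd ⧸ Subgroup.normalClosure {r | G.Relator T r}

/-- The natural map `Π_s` of a vertex group to the fundamental group; its image is the
vertex subgroup `G_s`. -/
def ofVertex {V : Type u} [Quiver.{v} V] [HasInvolutiveReverse V]
    (G : GraphOfGroups.{u, v, w, x} V) (T : MaximalTree V) (s : V) :
    G.vertexGroup s →* G.FundamentalGroup T :=
  (QuotientGroup.mk' _).comp (G.vertexGen s)

/-- The element `t_a` of the fundamental group. -/
def stable {V : Type u} [Quiver.{v} V] [HasInvolutiveReverse V]
    (G : GraphOfGroups.{u, v, w, x} V) (T : MaximalTree V) {s t : V} (a : s ⟶ t) :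
    G.FundamentalGroup T :=
  QuotientGroup.mk' _ (G.edgeGen a)

/-- The graph of the isomorphism `φ_a : G_a⁻ → G_a⁺`, for an arbitrary edge `a`, inside the
groups of its endpoints: `c` lies in `G_a⁻`, `d` lies in `G_a⁺`, and `d = φ_a(c)`.
If `a` is positive, `φ_a` sends `ϕ_a(k)` to `ϕ_{-a}(k)`; otherwise `-a` is positive,
and `φ_a` is the inverse of `φ_{-a}`. -/
inductive Transport {V : Type u} [Quiver.{v} V] [HasInvolutiveReverse V]
    (G : GraphOfGroups.{u, v, w, x} V) {s t : V} (a : s ⟶ t) :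
    G.vertexGroup s → G.vertexGroup t → Prop
  | pos (ha : G.IsPos a) (k : G.edgeGroup a ha) :
      Transport G a (G.toOrigin a ha k) (G.toExtremity a ha k)
  | neg (ha : G.IsPos (reverse a)) (k : G.edgeGroup (reverse a) ha) :
      Transport G a (G.toExtremity (reverse a) ha k) (G.toOrigin (reverse a) ha k)

/-- `G.Trajet u v` is the type of trajets from `u ∈ G_s` to `v ∈ G_t`, with origin `s` and
extremity `t`. Such a trajet consists of a path `(a₁, …, aₙ)` from `s = s₀` to `t = sₙ`, of pairs
`cᵢ⁻ ∈ G_{aᵢ}⁻`, `cᵢ⁺ = φ_{aᵢ}(cᵢ⁻)`, and of elements `hᵢ ∈ G_{sᵢ}` with `u = h₀ c₁⁻ h₀⁻¹`,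
`cᵢ⁺ = hᵢ cᵢ₊₁⁻ hᵢ⁻¹`, `cₙ⁺ = hₙ v hₙ⁻¹` in the groups of the vertices (`u = h₀ v h₀⁻¹` if `n = 0`).
It is built from its first edge on. -/
inductive Trajet {V : Type u} [Quiver.{v} V] [HasInvolutiveReverse V]
    (G : GraphOfGroups.{u, v, w, x} V) :
    ∀ {s t : V}, G.vertexGroup s → G.vertexGroup t → Type (max u v w)
  | trivial {s : V} {u v : G.vertexGroup s} (h : G.vertexGroup s) (hu : u = h * v * h⁻¹) :
      Trajet G u v
  | cons {s r t : V} {u : G.vertexGroup s} {v : G.vertexGroup t}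
      (h : G.vertexGroup s) (cminus : G.vertexGroup s) (a : s ⟶ r) (cplus : G.vertexGroup r)
      (hu : u = h * cminus * h⁻¹) (hc : G.Transport a cminus cplus)
      (rest : Trajet G cplus v) : Trajet G u v

/-- The label `h₀ t_{a₁} h₁ t_{a₂} ⋯ t_{aₙ} hₙ` of a trajet. -/
def Trajet.label {V : Type u} [Quiver.{v} V] [HasInvolutiveReverse V]
    {G : GraphOfGroups.{u, v, w, x} V} (T : MaximalTree V) :
    ∀ {s t : V} {u : G.vertexGroup s} {v : G.vertexGroup t},
      G.Trajet u v → G.FundamentalGroup T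
  | s, _, _, _, .trivial h _ => G.ofVertex T s h
  | s, _, _, _, .cons h _ a _ _ _ rest => G.ofVertex T s h * G.stable T a * rest.label T

/-- A circuit at `u ∈ G_s`, of origin `s`. -/
abbrev Circuit {V : Type u} [Quiver.{v} V] [HasInvolutiveReverse V]
    (G : GraphOfGroups.{u, v, w, x} V) {s : V} (u : G.vertexGroup s) : Type (max u v w) :=
  G.Trajet u u

/-- The set of the labels of the circuits at `u ∈ G_s`, of origin `s`. -/
def circuitLabels {V : Type u} [Quiver.{v} V] [HasInvolutiveReverse V]
    (G : GraphOfGroups.{u, v, w, x} V) (T : MaximalTree V) {s : V} (u : G.vertexGroup s) :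
    Set (G.FundamentalGroup T) :=
  {h | ∃ C : G.Circuit u, C.label T = h}

end GraphOfGroups

/-! A trajet lets `u` move through its label one letter at a time, by the relation `c⁻ t_a = t_a
c⁺`, until it comes out as `v`; this gives one implication (`Trajet.ofVertex_mul_label`). The
converse rests on a normal form. The fundamental group acts from the left on the normal words
between two fixed vertices, the maximal tree serving to change the origin of words. Three facts
about this action suffice: it respects the relators (`freeProdHom_relator`), it multiplies labels by
the acting element (`label_fundamentalGroupHom`), and it commutes with right multiplication by the
group of the extremity (`rmul_fundamentalGroupHom`). If `u h = h v`, apply both sides to a word `p`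
of label `1` on which `v` acts as right multiplication. Then `q = h p` has label `h`, and `u q = q
v` as words. Comparing letters turns `q` into a trajet (`exists_trajet`). The corollary is the case
`v = u`. -/

namespace GraphOfGroups

section

variable {V : Type u} [Quiver.{v} V] [HasInvolutiveReverse V]
  (G : GraphOfGroups.{u, v, w, x} V) (T : MaximalTree V)

/-! ### The isomorphisms carried by the edges -/

variable {G} in
theorem Transport.symm {s t : V} {a : s ⟶ t} {c : G.vertexGroup s} {d : G.vertexGroup t}
    (h : G.Transport a c d) : G.Transport (reverse a) d c := by
  cases h with
  | neg ha k => exact .pos ha k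
  | pos ha k =>
    have key : ∀ b : s ⟶ t, b = a → ∀ c d, G.Transport b c d → G.Transport a c d := by
      rintro b rfl c d h
      exact h
    have ha' : G.IsPos (reverse (reverse a)) := by rwa [reverse_reverse]
    -- `reverse (reverse a)` equals `a` only propositionally, and the edge groups depend on the
    -- edge; hence the detour through any `b = a`.
    have : ∀ b : s ⟶ t, b = a → ∃ hb : G.IsPos b, ∃ l : G.edgeGroup b hb,
        G.toOrigin b hb l = G.toOrigin a ha k ∧
          G.toExtremity b hb l = G.toExtremity a ha k := by
      rintro b rfl
      exact ⟨ha, k, rfl, rfl⟩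
    obtain ⟨hb, l, h₁, h₂⟩ := this _ (reverse_reverse a)
    rw [← h₁, ← h₂]
    exact .neg hb l

theorem transport_one {s t : V} (a : s ⟶ t) : G.Transport a 1 1 := by
  rcases G.isPos_xor a with ⟨ha, -⟩ | ⟨ha, -⟩
  · simpa using Transport.pos (G := G) (a := a) ha 1
  · simpa using Transport.neg (G := G) (a := a) ha 1

variable {G} in
theorem Transport.mul {s t : V} {a : s ⟶ t} {c c' : G.vertexGroup s} {d d' : G.vertexGroup t}
    (h : G.Transport a c d) (h' : G.Transport a c' d') : G.Transport a (c * c') (d * d') := by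
  have hx := G.isPos_xor a
  cases h with
  | pos ha k =>
    cases h' with
    | pos ha' k' => rw [← map_mul, ← map_mul]; exact .pos ha _
    | neg ha' k' => simp [ha, ha'] at hx
  | neg ha k =>
    cases h' with
    | pos ha' k' => simp [ha, ha'] at hx
    | neg ha' k' => rw [← map_mul, ← map_mul]; exact .neg ha _

variable {G} in
theorem Transport.inv {s t : V} {a : s ⟶ t} {c : G.vertexGroup s} {d : G.vertexGroup t}
    (h : G.Transport a c d) : G.Transport a c⁻¹ d⁻¹ := by
  cases h with
  | pos ha k => rw [← map_inv, ← map_inv]; exact .pos ha _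
  | neg ha k => rw [← map_inv, ← map_inv]; exact .neg ha _

variable {G} in
-- The pairs in `Transport a` form a subgroup of the product, so it suffices to treat `c = 1`, where
-- the injectivity of the edge monomorphisms decides.
theorem Transport.unique {s t : V} {a : s ⟶ t} {c : G.vertexGroup s} {d d' : G.vertexGroup t}
    (h : G.Transport a c d) (h' : G.Transport a c d') : d = d' := by
  have h1 := h.inv.mul h'
  rw [inv_mul_cancel] at h1
  have key : ∀ (c : G.vertexGroup s) (e : G.vertexGroup t),
      G.Transport a c e → c = 1 → e = 1 := by
    intro c e h hc
    cases h with
    | pos ha k =>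
      rw [(injective_iff_map_eq_one _).1 (G.toOrigin_injective a ha) k hc, map_one]
    | neg ha k =>
      rw [(injective_iff_map_eq_one _).1 (G.toExtremity_injective _ ha) k hc, map_one]
  exact inv_mul_eq_one.1 (key _ _ h1 rfl)

/-- The subgroup `G_a⁻` of the group of the origin of `a`. -/
def edgeSubgroup {s t : V} (a : s ⟶ t) : Subgroup (G.vertexGroup s) where
  carrier := {c | ∃ d, G.Transport a c d}
  one_mem' := ⟨1, G.transport_one a⟩
  mul_mem' := fun ⟨_, h⟩ ⟨_, h'⟩ => ⟨_, h.mul h'⟩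
  inv_mem' := fun ⟨_, h⟩ => ⟨_, h.inv⟩

open Classical in
/-- The isomorphism `φ_a`, extended by `1` outside of `G_a⁻`. -/
noncomputable def edgeMap {s t : V} (a : s ⟶ t) (c : G.vertexGroup s) : G.vertexGroup t :=
  if h : ∃ d, G.Transport a c d then h.choose else 1

theorem transport_edgeMap {s t : V} {a : s ⟶ t} {c : G.vertexGroup s}
    (hc : c ∈ G.edgeSubgroup a) : G.Transport a c (G.edgeMap a c) := by
  have h : ∃ d, G.Transport a c d := hc
  rw [edgeMap, dif_pos h]
  exact h.choose_spec

variable {G} in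
theorem Transport.edgeMap_eq {s t : V} {a : s ⟶ t} {c : G.vertexGroup s} {d : G.vertexGroup t}
    (h : G.Transport a c d) : G.edgeMap a c = d :=
  (G.transport_edgeMap ⟨d, h⟩).unique h

open Classical in
/-- The representative of a left coset of `G_a⁻`; that of `G_a⁻` itself is `1`. -/
noncomputable def cosetRep {s t : V} (a : s ⟶ t) (g : G.vertexGroup s) : G.vertexGroup s :=
  -- `out` could pick another element of the trivial coset; with `1` imposed, cancellation is
  -- detected by the letter `1` alone.
  if g ∈ G.edgeSubgroup a then 1 else (g : G.vertexGroup s ⧸ G.edgeSubgroup a).out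

theorem cosetRep_inv_mul_mem {s t : V} (a : s ⟶ t) (g : G.vertexGroup s) :
    (G.cosetRep a g)⁻¹ * g ∈ G.edgeSubgroup a := by
  unfold cosetRep
  split_ifs with h
  · simpa using h
  · exact QuotientGroup.eq.1 (QuotientGroup.out_eq' _)

theorem cosetRep_mul {s t : V} (a : s ⟶ t) (g : G.vertexGroup s) {c : G.vertexGroup s}
    (hc : c ∈ G.edgeSubgroup a) : G.cosetRep a (g * c) = G.cosetRep a g := by
  unfold cosetRep
  rw [Subgroup.mul_mem_cancel_right _ hc, QuotientGroup.mk_mul_of_mem g hc]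

theorem cosetRep_of_mem {s t : V} (a : s ⟶ t) {c : G.vertexGroup s}
    (hc : c ∈ G.edgeSubgroup a) : G.cosetRep a c = 1 :=
  if_pos hc

theorem cosetRep_eq_of_inv_mul_mem {s t : V} (a : s ⟶ t) {g g' : G.vertexGroup s}
    (h : g⁻¹ * g' ∈ G.edgeSubgroup a) : G.cosetRep a g' = G.cosetRep a g := by
  rw [← G.cosetRep_mul a g h, mul_inv_cancel_left]

theorem cosetRep_cosetRep {s t : V} (a : s ⟶ t) (g : G.vertexGroup s) :
    G.cosetRep a (G.cosetRep a g) = G.cosetRep a g :=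
  (G.cosetRep_eq_of_inv_mul_mem a (G.cosetRep_inv_mul_mem a g)).symm

theorem mem_of_cosetRep_eq_one {s t : V} {a : s ⟶ t} {g : G.vertexGroup s}
    (h : G.cosetRep a g = 1) : g ∈ G.edgeSubgroup a := by
  simpa [h] using G.cosetRep_inv_mul_mem a g

/-! ### Words -/

/-- The words `g₀ a₁ g₁ ⋯ aₙ gₙ` carried by the paths of extremity `t`. -/
inductive PathWord (t : V) : V → Type (max u v w)
  | nil (g : G.vertexGroup t) : PathWord t t
  | cons {s r : V} (g : G.vertexGroup s) (a : s ⟶ r) (p : PathWord t r) : PathWord t s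

namespace PathWord

variable {G} {t : V}

theorem cons_left_injective {s r : V} {g : G.vertexGroup s} {a : s ⟶ r} {p q : G.PathWord t r}
    (h : cons g a p = cons g a q) : p = q := by
  injection h

/-- A word is normal if each letter followed by an edge `a` represents a left coset of `G_a⁻`
and no edge is followed by `1` and its opposite. -/
def IsNormal : ∀ {s : V}, G.PathWord t s → Prop
  | _, nil _ => True
  | _, cons g a p => G.cosetRep a g = g ∧ (¬ ∃ q, p = cons 1 (reverse a) q) ∧ p.IsNormal

/-- Left multiplication by an element of the group of the origin. -/
noncomputable def lmul : ∀ {s : V}, G.vertexGroup s → G.PathWord t s → G.PathWord t s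
  | _, g, nil k => nil (g * k)
  -- The representative stays in front of `a`; the remaining factor lies in `G_a⁻` and is pushed
  -- across `a` by `φ_a`.
  | _, g, cons k a p => cons (G.cosetRep a (g * k)) a
      (lmul (G.edgeMap a ((G.cosetRep a (g * k))⁻¹ * (g * k))) p)

/-- Right multiplication by an element of the group of the extremity. -/
def rmul (g : G.vertexGroup t) : ∀ {s : V}, G.PathWord t s → G.PathWord t s
  | _, nil k => nil (k * g)
  | _, cons k a p => cons k a (p.rmul g)

open Classical in
/-- Left multiplication by an edge, followed by the cancellation of `a 1 (-a)` if it occurs. -/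
noncomputable def edgeMul {s r : V} (a : s ⟶ r) (p : G.PathWord t r) : G.PathWord t s :=
  if h : ∃ q, p = cons 1 (reverse a) q then h.choose else cons 1 a p

theorem edgeMul_cons {s r : V} (a : s ⟶ r) (q : G.PathWord t s) :
    edgeMul a (cons 1 (reverse a) q) = q := by
  have h : ∃ q', cons 1 (reverse a) q = cons 1 (reverse a) q' := ⟨q, rfl⟩
  rw [edgeMul, dif_pos h]
  exact (cons_left_injective h.choose_spec).symm

theorem edgeMul_of_not {s r : V} {a : s ⟶ r} {p : G.PathWord t r}
    (h : ¬ ∃ q, p = cons 1 (reverse a) q) : edgeMul a p = cons 1 a p :=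
  dif_neg h

theorem edgeMul_reverse_cons {s r : V} (a : s ⟶ r) (q : G.PathWord t r) :
    edgeMul (reverse a) (cons 1 a q) = q := by
  have h := edgeMul_cons (reverse a) q
  rwa [reverse_reverse] at h

/-- If `a` cancels against `p`, normality of `p` prevents the remaining word from cancelling with
`-a` in turn. -/
theorem edgeMul_reverse {s r : V} (a : s ⟶ r) {p : G.PathWord t r} (hp : p.IsNormal) :
    edgeMul (reverse a) (edgeMul a p) = p := by
  by_cases h : ∃ q, p = cons 1 (reverse a) q
  · obtain ⟨q, rfl⟩ := h
    rw [edgeMul_cons, edgeMul_of_not hp.2.1]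
  · rw [edgeMul_of_not h, edgeMul_reverse_cons]

theorem IsNormal.edgeMul {s r : V} (a : s ⟶ r) {p : G.PathWord t r} (hp : p.IsNormal) :
    (edgeMul a p).IsNormal := by
  by_cases h : ∃ q, p = cons 1 (reverse a) q
  · obtain ⟨q, rfl⟩ := h
    rw [edgeMul_cons]
    exact hp.2.2
  · rw [edgeMul_of_not h]
    exact ⟨G.cosetRep_of_mem a (one_mem _), h, hp⟩

theorem lmul_one : ∀ {s : V} {p : G.PathWord t s}, p.IsNormal → lmul 1 p = p
  | _, nil k, _ => by simp [lmul]
  | _, cons k a p, hp => by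
    rw [lmul, one_mul, hp.1, inv_mul_cancel, (G.transport_one a).edgeMap_eq, lmul_one hp.2.2]

theorem lmul_mul : ∀ {s : V} (g h : G.vertexGroup s) (p : G.PathWord t s),
    lmul (g * h) p = lmul g (lmul h p)
  | _, g, h, nil k => by simp [lmul, mul_assoc]
  | _, g, h, cons k a p => by
    have hc := G.cosetRep_inv_mul_mem a (h * k)
    have hrep : G.cosetRep a (g * h * k) = G.cosetRep a (g * G.cosetRep a (h * k)) := by
      apply G.cosetRep_eq_of_inv_mul_mem
      convert hc using 1
      group
    rw [lmul, lmul, lmul, ← lmul_mul, hrep]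
    congr 2
    -- The factor pushed across `a` by `g * h` is the product of those pushed by `g` and by `h`, and
    -- `φ_a` is multiplicative on `G_a⁻`.
    refine Eq.trans ?_ ((G.transport_edgeMap (G.cosetRep_inv_mul_mem a _)).mul
      (G.transport_edgeMap hc)).edgeMap_eq
    congr 1
    group

/-- An element of `G_a⁻` fixes the trivial coset, whose representative in a normal word is `1`.
Hence such a multiplication creates no new cancellation. -/
theorem eq_cons_one_of_lmul_eq {s r : V} {a : s ⟶ r} {g : G.vertexGroup s}
    (hg : g ∈ G.edgeSubgroup a) {p : G.PathWord t s} (hp : p.IsNormal) {q : G.PathWord t r}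
    (h : lmul g p = cons 1 a q) : ∃ q', p = cons 1 a q' := by
  cases p with
  | nil k => simp [lmul] at h
  | cons k b p =>
    rw [lmul] at h
    injection h with _ h₁ h₂ h₃
    subst h₁
    cases h₃
    have hk : k ∈ G.edgeSubgroup b :=
      (Subgroup.mul_mem_cancel_left _ hg).1 (G.mem_of_cosetRep_eq_one h₂)
    obtain rfl : k = 1 := by rw [← hp.1, G.cosetRep_of_mem b hk]
    exact ⟨p, rfl⟩

theorem IsNormal.lmul : ∀ {s : V} (g : G.vertexGroup s) {p : G.PathWord t s},
    p.IsNormal → (lmul g p).IsNormal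
  | _, _, nil _, _ => trivial
  | _, g, cons k a p, hp => by
    refine ⟨G.cosetRep_cosetRep a _, ?_, IsNormal.lmul _ hp.2.2⟩
    rintro ⟨q, hq⟩
    exact hp.2.1 (eq_cons_one_of_lmul_eq
      ⟨_, (G.transport_edgeMap (G.cosetRep_inv_mul_mem a _)).symm⟩ hp.2.2 hq)

/-- This is the relation `c t_a = t_a d` on words. Multiplication by `d` neither creates nor
destroys a cancellation with `a`, so both sides fall in the same case of `edgeMul`. -/
theorem lmul_edgeMul {s r : V} {a : s ⟶ r} {c : G.vertexGroup s} {d : G.vertexGroup r}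
    (h : G.Transport a c d) {p : G.PathWord t r} (hp : p.IsNormal) :
    lmul c (edgeMul a p) = edgeMul a (lmul d p) := by
  by_cases hq : ∃ q, p = cons 1 (reverse a) q
  · obtain ⟨q, rfl⟩ := hq
    have hd : d ∈ G.edgeSubgroup (reverse a) := ⟨c, h.symm⟩
    rw [edgeMul_cons, lmul, mul_one, G.cosetRep_of_mem _ hd, inv_one, one_mul,
      h.symm.edgeMap_eq, edgeMul_cons]
  · have hc : c ∈ G.edgeSubgroup a := ⟨d, h⟩
    rw [edgeMul_of_not hq, edgeMul_of_not, lmul, mul_one, G.cosetRep_of_mem _ hc, inv_one,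
      one_mul, h.edgeMap_eq]
    rintro ⟨q, h'⟩
    exact hq (eq_cons_one_of_lmul_eq ⟨c, h.symm⟩ hp h')

theorem rmul_lmul (k : G.vertexGroup t) : ∀ {s : V} (g : G.vertexGroup s) (p : G.PathWord t s),
    (lmul g p).rmul k = lmul g (p.rmul k)
  | _, g, nil l => by simp [lmul, rmul, mul_assoc]
  | _, g, cons l a p => by simp [lmul, rmul, rmul_lmul]

/-- Right multiplication alters only the last letter, which no edge follows, so it does not affect
cancellation. -/
theorem exists_rmul_eq_cons {k : G.vertexGroup t} {s r : V} {g : G.vertexGroup s} {a : s ⟶ r}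
    {p : G.PathWord t s} : (∃ q, p.rmul k = cons g a q) ↔ ∃ q, p = cons g a q := by
  constructor
  · rintro ⟨q, h⟩
    cases p with
    | nil l => simp [rmul] at h
    | cons l b p =>
      rw [rmul] at h
      injection h with _ h₁ h₂ h₃
      subst h₁
      cases h₂
      cases h₃
      exact ⟨p, rfl⟩
  · rintro ⟨q, rfl⟩
    exact ⟨_, rfl⟩

theorem rmul_edgeMul (k : G.vertexGroup t) {s r : V} (a : s ⟶ r) (p : G.PathWord t r) :
    (edgeMul a p).rmul k = edgeMul a (p.rmul k) := by
  by_cases h : ∃ q, p = cons 1 (reverse a) q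
  · obtain ⟨q, rfl⟩ := h
    rw [edgeMul_cons, rmul, edgeMul_cons]
  · rw [edgeMul_of_not h, edgeMul_of_not (mt exists_rmul_eq_cons.1 h), rmul]

theorem IsNormal.rmul (k : G.vertexGroup t) : ∀ {s : V} {p : G.PathWord t s},
    p.IsNormal → (p.rmul k).IsNormal
  | _, nil _, _ => trivial
  | _, cons _ _ _, hp => ⟨hp.1, mt exists_rmul_eq_cons.1 hp.2.1, hp.2.2.rmul k⟩

/-- The element of the fundamental group represented by a word. -/
def label : ∀ {s : V}, G.PathWord t s → G.FundamentalGroup T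
  | _, nil g => G.ofVertex T _ g
  | _, cons g a p => G.ofVertex T _ g * G.stable T a * p.label

end PathWord

/-! ### The relations of the fundamental group -/

theorem stable_reverse {s t : V} (a : s ⟶ t) : G.stable T (reverse a) = (G.stable T a)⁻¹ := by
  have h := (QuotientGroup.eq_one_iff _).2
    (Subgroup.subset_normalClosure (s := {r | G.Relator T r}) (Relator.inv a))
  exact mul_inv_eq_one.1 h

theorem stable_eq_one {s t : V} {a : s ⟶ t} (ha : a ∈ T.edges s t) : G.stable T a = 1 :=
  (QuotientGroup.eq_one_iff _).2
    (Subgroup.subset_normalClosure (s := {r | G.Relator T r}) (Relator.tree a ha))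

variable {G} in
theorem Transport.ofVertex_mul_stable {s t : V} {a : s ⟶ t} {c : G.vertexGroup s}
    {d : G.vertexGroup t} (h : G.Transport a c d) :
    G.ofVertex T s c * G.stable T a = G.stable T a * G.ofVertex T t d := by
  have key : ∀ {s t : V} (a : s ⟶ t) (ha : G.IsPos a) (k : G.edgeGroup a ha),
      G.ofVertex T s (G.toOrigin a ha k) =
        G.stable T a * G.ofVertex T t (G.toExtremity a ha k) * (G.stable T a)⁻¹ := by
    intro s t a ha k
    have h := (QuotientGroup.eq_one_iff _).2
      (Subgroup.subset_normalClosure (s := {r | G.Relator T r}) (Relator.conj a ha k))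
    exact mul_inv_eq_one.1 h
  cases h with
  | pos ha k => rw [key, inv_mul_cancel_right]
  | neg ha k => rw [key, stable_reverse]; group

variable {G} in
-- Each `h` conjugates the current element to the next `c⁻`, and each edge replaces `c⁻` by `c⁺`.
theorem Trajet.ofVertex_mul_label {s t : V} {u : G.vertexGroup s} {v : G.vertexGroup t}
    (C : G.Trajet u v) : G.ofVertex T s u * C.label T = C.label T * G.ofVertex T t v := by
  induction C with
  | trivial h hu => rw [label, hu, ← map_mul, ← map_mul, inv_mul_cancel_right]
  | cons h c a d hu hc rest ih =>
    rw [label, mul_assoc _ (rest.label T), ← ih, hu]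
    simp only [mul_assoc, map_mul, map_inv, inv_mul_cancel_left]
    rw [← mul_assoc (G.stable T a), ← hc.ofVertex_mul_stable]
    simp only [mul_assoc]

namespace PathWord

variable {G} {t : V}

theorem label_lmul : ∀ {s : V} (g : G.vertexGroup s) (p : G.PathWord t s),
    (lmul g p).label T = G.ofVertex T s g * p.label T
  | _, g, nil k => by simp [lmul, label]
  | _, g, cons k a p => by
    rw [lmul, label, label, label_lmul, mul_assoc, ← mul_assoc (G.stable T a),
      ← (G.transport_edgeMap (G.cosetRep_inv_mul_mem a (g * k))).ofVertex_mul_stable]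
    simp [mul_assoc]

theorem label_edgeMul {s r : V} (a : s ⟶ r) (p : G.PathWord t r) :
    (edgeMul a p).label T = G.stable T a * p.label T := by
  by_cases h : ∃ q, p = cons 1 (reverse a) q
  · obtain ⟨q, rfl⟩ := h
    rw [edgeMul_cons, label, stable_reverse]
    simp
  · rw [edgeMul_of_not h, label, map_one, one_mul]

/-- If a word intertwines `u` and `v`, its letters are those of a trajet. -/
theorem exists_trajet {v : G.vertexGroup t} : ∀ {s : V} {u : G.vertexGroup s}
    (p : G.PathWord t s), lmul u p = p.rmul v → ∃ C : G.Trajet u v, C.label T = p.label T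
  | _, u, nil k, h => by
    simp only [lmul, rmul] at h
    injection h with h
    exact ⟨.trivial k (by rw [← h, mul_inv_cancel_right]), rfl⟩
  | _, u, cons k a p, h => by
    rw [lmul, rmul] at h
    -- Equal first letters mean that `k` represents the coset of `u * k`, so `u = k c k⁻¹` with `c`
    -- in `G_a⁻`. Equal tails mean that `p` intertwines `φ_a(c)` and `v`.
    injection h with _ _ h₁ _ h₂
    obtain ⟨C, hC⟩ := exists_trajet p h₂
    have hc := G.cosetRep_inv_mul_mem a (u * k)
    refine ⟨.cons k _ a _ ?_ (G.transport_edgeMap hc) C, ?_⟩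
    · rw [h₁]; group
    · rw [Trajet.label, label, hC]

end PathWord

/-! ### The action on the normal words -/

/-- The normal words from `s` to `t`. -/
def NormalWord (t s : V) : Type (max u v w) := {p : G.PathWord t s // p.IsNormal}

namespace NormalWord

variable {G} {t : V}

/-- The action of a vertex group on the normal words by left multiplication. -/
noncomputable def vertexHom (t s : V) : G.vertexGroup s →* Equiv.Perm (G.NormalWord t s) :=
  letI : MulAction (G.vertexGroup s) (G.NormalWord t s) :=
    { smul := fun g p => ⟨p.1.lmul g, p.2.lmul g⟩
      one_smul := fun p => Subtype.ext (PathWord.lmul_one p.2)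
      mul_smul := fun g h p => Subtype.ext (PathWord.lmul_mul g h p.1) }
  MulAction.toPermHom _ _

@[simp]
theorem coe_vertexHom {s : V} (g : G.vertexGroup s) (p : G.NormalWord t s) :
    (vertexHom t s g p).1 = p.1.lmul g := rfl

/-- The bijection between normal words given by left multiplication by an edge. -/
noncomputable def edgeEquiv (t : V) {s r : V} (a : s ⟶ r) : G.NormalWord t r ≃ G.NormalWord t s where
  toFun p := ⟨p.1.edgeMul a, p.2.edgeMul a⟩
  invFun p := ⟨p.1.edgeMul (reverse a), p.2.edgeMul _⟩
  left_inv p := Subtype.ext (PathWord.edgeMul_reverse a p.2)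
  right_inv p := Subtype.ext (by
    have h := PathWord.edgeMul_reverse (reverse a) p.2
    rwa [reverse_reverse] at h)

@[simp]
theorem coe_edgeEquiv {s r : V} (a : s ⟶ r) (p : G.NormalWord t r) :
    (edgeEquiv t a p).1 = p.1.edgeMul a := rfl

theorem edgeEquiv_reverse {s r : V} (a : s ⟶ r) :
    edgeEquiv (G := G) t (reverse a) = (edgeEquiv t a).symm :=
  Equiv.ext fun _ => rfl

/-- The bijection between normal words given by left multiplication by a path. -/
noncomputable def pathEquiv (t : V) {s : V} : ∀ {r : V}, Path s r → (G.NormalWord t r ≃ G.NormalWord t s)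
  | _, .nil => Equiv.refl _
  | _, .cons p a => (edgeEquiv t a).trans (pathEquiv t p)

/-- Right multiplication on normal words. -/
def rmul (k : G.vertexGroup t) {s : V} (p : G.NormalWord t s) : G.NormalWord t s :=
  ⟨p.1.rmul k, p.2.rmul k⟩

theorem rmul_vertexHom (k : G.vertexGroup t) {s : V} (g : G.vertexGroup s)
    (p : G.NormalWord t s) : (vertexHom t s g p).rmul k = vertexHom t s g (p.rmul k) :=
  Subtype.ext (PathWord.rmul_lmul k g p.1)

theorem rmul_edgeEquiv (k : G.vertexGroup t) {s r : V} (a : s ⟶ r) (p : G.NormalWord t r) :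
    (edgeEquiv t a p).rmul k = edgeEquiv t a (p.rmul k) :=
  Subtype.ext (PathWord.rmul_edgeMul k a p.1)

theorem rmul_pathEquiv (k : G.vertexGroup t) {s : V} : ∀ {r : V} (p : Path s r)
    (q : G.NormalWord t r), (pathEquiv t p q).rmul k = pathEquiv t p (q.rmul k)
  | _, .nil, _ => rfl
  | _, .cons p a, q => by
    simp only [pathEquiv, Equiv.trans_apply]
    rw [rmul_pathEquiv, rmul_edgeEquiv]

theorem label_pathEquiv {s : V} : ∀ {r : V} (p : Path s r), p.EdgesIn T.edges →
    ∀ q : G.NormalWord t r, (pathEquiv t p q).1.label T = q.1.label T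
  | _, .nil, _, _ => rfl
  | _, .cons p a, hp, q => by
    simp only [pathEquiv, Equiv.trans_apply]
    rw [label_pathEquiv p hp.1, coe_edgeEquiv, PathWord.label_edgeMul, G.stable_eq_one T hp.2,
      one_mul]

end NormalWord

end

end GraphOfGroups

/-! ### Reduced paths in the maximal tree -/

namespace MaximalTree

variable {V : Type u} [Quiver.{v} V] [HasInvolutiveReverse V] (T : MaximalTree V)

/-- The reduced path of the tree between two vertices. -/
noncomputable def path (s t : V) : Path s t := (T.existsUnique_path s t).choose

theorem path_edgesIn (s t : V) : (T.path s t).EdgesIn T.edges :=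
  (T.existsUnique_path s t).choose_spec.1.1

theorem path_isReducedPath (s t : V) : (T.path s t).IsReducedPath :=
  (T.existsUnique_path s t).choose_spec.1.2

theorem eq_path {s t : V} {p : Path s t} (h : p.EdgesIn T.edges) (h' : p.IsReducedPath) :
    p = T.path s t :=
  (T.existsUnique_path s t).choose_spec.2 p ⟨h, h'⟩

theorem path_self (s : V) : T.path s s = .nil := by
  have hE : (Path.nil : Path s s).EdgesIn T.edges := trivial
  refine (T.eq_path hE ?_).symm
  intro y z q a r h
  have := congrArg Path.length h
  simp only [Path.length_comp, Path.length_cons, Path.length_nil] at this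
  omega

/-- The tree path to one endpoint of an edge of the tree is the tree path to the other one,
extended by that edge. -/
theorem path_eq_cons_or (b : V) {s r : V} {a : s ⟶ r} (ha : a ∈ T.edges s r) :
    T.path b r = (T.path b s).cons a ∨ T.path b s = (T.path b r).cons (reverse a) := by
  by_cases h : ((T.path b s).cons a).IsReducedPath
  · have hE : ((T.path b s).cons a).EdgesIn T.edges := ⟨T.path_edgesIn b s, ha⟩
    exact .inl (T.eq_path hE h).symm
  · right
    simp only [Path.IsReducedPath, not_forall, not_not] at h
    obtain ⟨y, z, q, e, p, hp⟩ := h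
    -- As `T.path b s` is reduced, the backtracking sits at the very end: `T.path b s` ends with the
    -- opposite of `a`. What precedes is a prefix of a reduced path, hence the tree path to `r`.
    cases p with
    | cons p e' =>
      rw [Path.comp_cons] at hp
      injection hp with h₁ _ h₂ h₃
      subst h₁
      exact absurd (eq_of_heq h₂) (T.path_isReducedPath b s q e p)
    | nil =>
      rw [Path.comp_nil] at hp
      injection hp with h₁ _ h₂ h₃
      subst h₁
      cases h₃
      have hs := eq_of_heq h₂
      have hE := T.path_edgesIn b s
      have hR := T.path_isReducedPath b s
      rw [hs] at hE hR
      rw [reverse_reverse, hs]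
      congr 1
      refine T.eq_path hE.1 fun y z q' f p' h => hR q' f (p'.cons e) ?_
      rw [h, Path.comp_cons]

end MaximalTree

/-! ### The action of the fundamental group on normal words -/

namespace GraphOfGroups

section

variable {V : Type u} [Quiver.{v} V] [HasInvolutiveReverse V]
  {G : GraphOfGroups.{u, v, w, x} V} (T : MaximalTree V)

theorem FreeProd.induction {P : G.FreeProd → Prop}
    (vertex : ∀ s g, P (G.vertexGen s g)) (edge : ∀ {s t : V} (a : s ⟶ t), P (G.edgeGen a))
    (one : P 1) (mul : ∀ y z, P y → P z → P (y * z)) (inv : ∀ y, P y → P y⁻¹) (y : G.FreeProd) :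
    P y := by
  induction y using Monoid.Coprod.induction_on with
  | inl m =>
    induction m using Monoid.CoprodI.induction_on with
    | one => simpa using one
    | of s g => exact vertex s g
    | mul y z hy hz => simpa using mul _ _ hy hz
  | inr n =>
    induction n using FreeGroup.induction_on with
    | C1 => simpa using one
    | of e => exact edge e.hom
    | inv_of e h => simpa using inv _ h
    | mul y z hy hz => simpa using mul _ _ hy hz
  | mul y z hy hz => exact mul y z hy hz

namespace NormalWord

/-- The action of the free product on the normal words from `b` to `t`. -/
noncomputable def freeProdHom (t b : V) : G.FreeProd →* Equiv.Perm (G.NormalWord t b) :=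
  -- A word of origin `b` is carried along the tree to the vertex where the generator acts, and the
  -- result is carried back to `b`.
  Monoid.Coprod.lift
    (Monoid.CoprodI.lift fun s =>
      (pathEquiv t (T.path b s)).permCongrHom.toMonoidHom.comp (vertexHom t s))
    (FreeGroup.lift fun e =>
      (pathEquiv t (T.path b e.right)).symm.trans
        ((edgeEquiv t e.hom).trans (pathEquiv t (T.path b e.left))))

theorem freeProdHom_vertexGen (t b : V) {s : V} (g : G.vertexGroup s) :
    freeProdHom T t b (G.vertexGen s g) =
      (pathEquiv t (T.path b s)).permCongr (vertexHom t s g) := by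
  simp [freeProdHom, vertexGen, Equiv.permCongrHom]

theorem freeProdHom_edgeGen (t b : V) {s r : V} (a : s ⟶ r) :
    freeProdHom T t b (G.edgeGen a) = (pathEquiv t (T.path b r)).symm.trans
      ((edgeEquiv t a).trans (pathEquiv t (T.path b s))) := by
  simp [freeProdHom, edgeGen]

/-- Between neighbouring generators the tree paths cancel. The conjugation relators then reduce to
`lmul_edgeMul`. An edge of the tree acts trivially because it extends the tree path to one of its
ends into the tree path to the other. -/
theorem freeProdHom_relator (t b : V) {y : G.FreeProd} (hy : G.Relator T y) :
    freeProdHom T t b y = 1 := by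
  cases hy with
  | conj a ha k =>
    rw [map_mul, map_inv, mul_inv_eq_one, map_mul, map_inv, eq_mul_inv_iff_mul_eq, map_mul,
      freeProdHom_vertexGen, freeProdHom_vertexGen, freeProdHom_edgeGen]
    ext1 p
    simp only [Equiv.Perm.mul_apply, Equiv.permCongr_apply, Equiv.trans_apply,
      Equiv.symm_apply_apply]
    congr 1
    exact Subtype.ext (PathWord.lmul_edgeMul (Transport.pos ha k) (Subtype.prop _))
  | inv a =>
    rw [map_mul, map_inv, mul_inv_eq_one, map_inv, eq_inv_iff_mul_eq_one, freeProdHom_edgeGen,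
      freeProdHom_edgeGen, edgeEquiv_reverse]
    ext1 p
    simp
  | @tree s r a ha =>
    rw [freeProdHom_edgeGen]
    ext1 p
    rcases T.path_eq_cons_or b ha with h | h
    · rw [h]
      simp [pathEquiv]
    · rw [h]
      simp [pathEquiv, edgeEquiv_reverse]

/-- The action of the fundamental group on the normal words from `b` to `t`. -/
noncomputable def fundamentalGroupHom (t b : V) : G.FundamentalGroup T →* Equiv.Perm (G.NormalWord t b) :=
  QuotientGroup.lift _ (freeProdHom T t b) fun _ hy =>
    (Subgroup.normalClosure_le_normal (N := (freeProdHom T t b).ker)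
      (fun _ hr => freeProdHom_relator T t b hr)) hy

theorem fundamentalGroupHom_ofVertex (t b : V) {s : V} (g : G.vertexGroup s) :
    fundamentalGroupHom T t b (G.ofVertex T s g) =
      (pathEquiv t (T.path b s)).permCongr (vertexHom t s g) :=
  freeProdHom_vertexGen T t b g

theorem rmul_fundamentalGroupHom {t b : V} (k : G.vertexGroup t) (h : G.FundamentalGroup T)
    (p : G.NormalWord t b) :
    (fundamentalGroupHom T t b h p).rmul k = fundamentalGroupHom T t b h (p.rmul k) := by
  have symm_comm : ∀ {s : V} (q : Path b s) (p : G.NormalWord t b),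
      ((pathEquiv t q).symm p).rmul k = (pathEquiv t q).symm (p.rmul k) := fun q p => by
    rw [Equiv.eq_symm_apply, ← rmul_pathEquiv, Equiv.apply_symm_apply]
  obtain ⟨y, rfl⟩ := QuotientGroup.mk_surjective h
  change (freeProdHom T t b y p).rmul k = freeProdHom T t b y (p.rmul k)
  induction y using FreeProd.induction generalizing p with
  | vertex s g =>
    simp only [freeProdHom_vertexGen, Equiv.permCongr_apply, rmul_pathEquiv, rmul_vertexHom,
      symm_comm]
  | edge a =>
    simp only [freeProdHom_edgeGen, Equiv.trans_apply, rmul_pathEquiv, rmul_edgeEquiv, symm_comm]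
  | one => simp
  | mul y z hy hz => simp [hy, hz]
  | inv y hy => rw [map_inv, Equiv.Perm.eq_inv_iff_eq, ← hy, ← Equiv.Perm.mul_apply,
      mul_inv_cancel, Equiv.Perm.one_apply]

/-- The detours along the tree do not change labels, since `t_a = 1` on its edges; it remains to
check the generators. -/
theorem label_fundamentalGroupHom {t b : V} (h : G.FundamentalGroup T) (p : G.NormalWord t b) :
    (fundamentalGroupHom T t b h p).1.label T = h * p.1.label T := by
  have symm_label : ∀ {s : V} (p : G.NormalWord t b),
      ((pathEquiv t (T.path b s)).symm p).1.label T = p.1.label T := fun p => by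
    rw [← label_pathEquiv T _ (T.path_edgesIn b _), Equiv.apply_symm_apply]
  obtain ⟨y, rfl⟩ := QuotientGroup.mk_surjective h
  change (freeProdHom T t b y p).1.label T = _
  induction y using FreeProd.induction generalizing p with
  | vertex s g =>
    rw [freeProdHom_vertexGen, Equiv.permCongr_apply, label_pathEquiv T _ (T.path_edgesIn b s),
      coe_vertexHom, PathWord.label_lmul, symm_label]
    rfl
  | @edge s r a =>
    rw [freeProdHom_edgeGen, Equiv.trans_apply, Equiv.trans_apply,
      label_pathEquiv T _ (T.path_edgesIn b s), coe_edgeEquiv, PathWord.label_edgeMul, symm_label]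
    rfl
  | one => simp
  | mul y z hy hz =>
    rw [map_mul, Equiv.Perm.mul_apply, hy, hz, ← mul_assoc]
    rfl
  | inv y hy =>
    have h := hy ((freeProdHom T t b y)⁻¹ p)
    rw [← Equiv.Perm.mul_apply, mul_inv_cancel, Equiv.Perm.one_apply] at h
    rw [map_inv, h, QuotientGroup.mk_inv, inv_mul_cancel_left]

end NormalWord

theorem exists_trajet_of_eq_conj {s t : V} {u : G.vertexGroup s} {v : G.vertexGroup t}
    {h : G.FundamentalGroup T} (huv : G.ofVertex T s u = h * G.ofVertex T t v * h⁻¹) :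
    ∃ C : G.Trajet u v, C.label T = h := by
  let p₀ : G.NormalWord t t := ⟨.nil 1, trivial⟩
  -- The tree path from `s` to `t` read as a word; its label is `1`.
  let p : G.NormalWord t s := NormalWord.pathEquiv t (T.path s t) p₀
  let q := NormalWord.fundamentalGroupHom T t s h p
  -- Carried back along the tree, `p` becomes the one-letter word `1`, on which left and right
  -- multiplication by `v` agree.
  have hp : NormalWord.fundamentalGroupHom T t s (G.ofVertex T t v) p = p.rmul v := by
    rw [NormalWord.fundamentalGroupHom_ofVertex, Equiv.permCongr_apply, Equiv.symm_apply_apply,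
      NormalWord.rmul_pathEquiv]
    congr 1
    refine Subtype.ext ?_
    rw [NormalWord.coe_vertexHom]
    simp [p₀, NormalWord.rmul, PathWord.rmul, PathWord.lmul]
  have hq : NormalWord.fundamentalGroupHom T t s (G.ofVertex T s u) q = q.rmul v := by
    rw [NormalWord.rmul_fundamentalGroupHom, ← hp, ← Equiv.Perm.mul_apply,
      ← Equiv.Perm.mul_apply, ← map_mul, ← map_mul, huv, inv_mul_cancel_right]
  -- The words start at the vertex of `u`, so no tree path intervenes and `u` acts by plain left
  -- multiplication.
  rw [NormalWord.fundamentalGroupHom_ofVertex, T.path_self] at hq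
  obtain ⟨C, hC⟩ := PathWord.exists_trajet T q.1 (congrArg Subtype.val hq)
  refine ⟨C, hC.trans ?_⟩
  rw [NormalWord.label_fundamentalGroupHom,
    NormalWord.label_pathEquiv T _ (T.path_edgesIn s t)]
  simp [p₀, PathWord.label]

theorem eq_conj_iff_exists_trajet {s t : V} {u : G.vertexGroup s} {v : G.vertexGroup t}
    {h : G.FundamentalGroup T} : G.ofVertex T s u = h * G.ofVertex T t v * h⁻¹ ↔
      ∃ C : G.Trajet u v, C.label T = h := by
  refine ⟨exists_trajet_of_eq_conj T, ?_⟩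
  rintro ⟨C, rfl⟩
  exact eq_mul_inv_of_mul_eq (C.ofVertex_mul_label T)

end

end GraphOfGroups

theorem mainTheorem3 {V : Type u} [Quiver.{v} V] [HasInvolutiveReverse V]
    [Finite V] [∀ s t : V, Finite (s ⟶ t)]
    (G : GraphOfGroups.{u, v, w, x} V) (T : MaximalTree V) :
    (∀ (s₁ s₂ : V) (u : G.vertexGroup s₁) (v : G.vertexGroup s₂) (h : G.FundamentalGroup T),
      G.ofVertex T s₁ u = h * G.ofVertex T s₂ v * h⁻¹ ↔
        ∃ C : G.Trajet u v, C.label T = h) ∧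
    (∀ (s : V) (u : G.vertexGroup s),
      (Subgroup.centralizer {G.ofVertex T s u} : Set (G.FundamentalGroup T)) =
        G.circuitLabels T u) := by
  refine ⟨fun _ _ _ _ _ => GraphOfGroups.eq_conj_iff_exists_trajet T, fun s u => ?_⟩
  ext h
  rw [SetLike.mem_coe, Subgroup.mem_centralizer_singleton_iff, GraphOfGroups.circuitLabels,
    Set.mem_ofPred_eq, ← GraphOfGroups.eq_conj_iff_exists_trajet, eq_mul_inv_iff_mul_eq]
  exact eq_comm
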